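/- Let $G$ be a finite group with identity $e$. Let $\lambda$ be the left regular representation of $G$ on the complex-valued functions on $G$, $(\lambda(g)f)(h)=f(g^{-1}h)$, and let $\mathcal{L}G$ be the complex linear span of the operators $\lambda(g)$, $g\in G$, which form a basis of it. For a function $l:G\to\mathbb{R}$ and $t\ge 0$ let $P_t:\mathcal{L}G\to\mathcal{L}G$ be the linear map with $P_t\lambda(g)=e^{-t\,l(g)}\lambda(g)$ for all $g\in G$. Let $\chi_1,\dots,\chi_m$ be the distinct irreducible complex characters of $G$ and let $\sigma_r:\mathcal{L}G\to\mathcal{L}G$ be the linear map with $\sigma_r\lambda(g)=\chi_r(g)\lambda(g)$ for all $g\in G$. A character-induced Kraus-like decomposition of $P_t$ consists of functions $p_1,\dots,p_m:[0,\infty)\to\mathbb{C}$ such that $P_t=\sum_{r=1}^m p_r(t)\,\sigma_r$ for all $t\ge 0$. It is called convex if $p_r(t)\ge 0$ (that is, $p_r(t)$ is real and nonnegative) for all $r$ and all $t\ge 0$, and the sum rule $\sum_{r=1}^m p_r(t)\,\chi_r(e)=1$ holds for all $t\ge 0$. A function $l:G\to\mathbb{R}$ is a length if $l(e)=0$, $l(g)=l(g^{-1})$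 and $l(g)\ge 0$ for all $g\in G$. A length $l$ is conditionally negative-definite if for all $n$, all $g_1,\dots,g_n\in G$ and all $\alpha_1,\dots,\alpha_n\in\mathbb{C}$ with $\sum_{i=1}^n\alpha_i=0$ one has $\sum_{i,j=1}^n\alpha_i\overline{\alpha_j}\,l(g_i^{-1}g_j)\le 0$. Theorem. Let $l:G\to\mathbb{R}$ be a class function (that is, $l(g)=l(h^{-1}gh)$ for all $g,h\in G$) with $l(e)=0$. Then $P_t$ has exactly one character-induced Kraus-like decomposition, and this decomposition is convex if and only if $l$ is a conditionally negative-definite length. The equivalence also holds if the sum rule in the definition of convexity is replaced by the requirement that $\sum_{r=1}^m\alpha_r\,p_r(t)=1$ for all $t\ge 0$, for some positive real numbers $\alpha_1,\dots,\alpha_m$ that do not depend on $t$. -/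

import Mathlib

open scoped ComplexOrder NNReal

namespace KrausLike

noncomputable section

/-- The left regular representation of `G` on the complex-valued functions on `G`:
`(λ(g) f)(h) = f (g⁻¹ h)`. -/
def leftReg (G : Type*) [Group G] : Representation ℂ G (G → ℂ) where
  toFun g := LinearMap.funLeft ℂ ℂ (fun h => g⁻¹ * h)
  map_one' := by
    ext f h
    simp [LinearMap.funLeft]
  map_mul' a b := by
    ext f h
    simp [LinearMap.funLeft, mul_assoc]

theorem leftReg_apply {G : Type*} [Group G] (g : G) (f : G → ℂ) (h : G) :
    leftReg G g f h = f (g⁻¹ * h) := rfl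

/-- The group algebra `ℒG`: the complex linear span of the operators `λ(g)`, `g ∈ G`. -/
def groupAlg (G : Type*) [Group G] : Submodule ℂ (Module.End ℂ (G → ℂ)) :=
  Submodule.span ℂ (Set.range (leftReg G))

open Classical in
theorem leftReg_linearIndependent (G : Type*) [Group G] :
    LinearIndependent ℂ (fun g : G => leftReg G g) := by
  rw [linearIndependent_iff']
  intro s c hc g hg
  have h1 := congrFun (LinearMap.congr_fun hc (Pi.single (1 : G) (1 : ℂ))) g
  simp only [LinearMap.sum_apply, LinearMap.smul_apply, Finset.sum_apply, Pi.smul_apply,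
    leftReg_apply, LinearMap.zero_apply, Pi.zero_apply, Pi.single_apply, inv_mul_eq_one,
    smul_eq_mul, mul_ite, mul_one, mul_zero] at h1
  simpa [hg] using h1

/-- The operators `λ(g)` as a basis of `ℒG`. -/
def lambdaBasis (G : Type*) [Group G] : Module.Basis G ℂ (groupAlg G) :=
  Module.Basis.span (leftReg_linearIndependent G)

theorem coe_lambdaBasis {G : Type*} [Group G] (g : G) :
    (lambdaBasis G g : Module.End ℂ (G → ℂ)) = leftReg G g :=
  congrArg Subtype.val (Module.Basis.span_apply (leftReg_linearIndependent G) g)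

/-- The linear extension to `ℒG` of `λ(g) ↦ φ(g) λ(g)`. -/
def multiplier {G : Type*} [Group G] (φ : G → ℂ) : groupAlg G →ₗ[ℂ] groupAlg G :=
  (lambdaBasis G).constr ℂ (fun g => φ g • lambdaBasis G g)

theorem multiplier_lambda {G : Type*} [Group G] (φ : G → ℂ) (g : G) :
    multiplier φ (lambdaBasis G g) = φ g • lambdaBasis G g :=
  (lambdaBasis G).constr_basis ℂ _ g

/-- The semigroup `P_t`, `t ≥ 0`, induced by `l`: `P_t λ(g) = e^{-t l(g)} λ(g)`. -/
def semigroup {G : Type*} [Group G] (l : G → ℝ) (t : ℝ≥0) : groupAlg G →ₗ[ℂ] groupAlg G :=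
  multiplier (fun g => (Real.exp (-(t : ℝ) * l g) : ℂ))

/-- `l` is constant on conjugacy classes. -/
def IsClassFunction {G : Type*} [Group G] (l : G → ℝ) : Prop :=
  ∀ g h : G, l g = l (h⁻¹ * g * h)

/-- Length functions on a group. -/
structure IsLength {G : Type*} [Group G] (l : G → ℝ) : Prop where
  map_one : l 1 = 0
  map_inv : ∀ g, l g = l g⁻¹
  nonneg : ∀ g, 0 ≤ l g

/-- Conditionally negative-definite length functions. The inequality is that of `ℂ`, that is,
the left-hand side is real and nonpositive. -/
structure IsCondNegDefLength {G : Type*} [Group G] (l : G → ℝ) : Prop extends IsLength l where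
  sum_nonpos : ∀ (n : ℕ) (α : Fin n → ℂ) (g : Fin n → G), ∑ i, α i = 0 →
    ∑ i, ∑ j, α i * starRingEnd ℂ (α j) * (l ((g i)⁻¹ * g j) : ℂ) ≤ 0

/-- The set of irreducible complex characters of `G`: the characters of the irreducible
representations on the spaces `ℂⁿ`. -/
def irrChars (G : Type*) [Group G] : Set (G → ℂ) :=
  {χ | ∃ (n : ℕ) (ρ : Representation ℂ G (Fin n → ℂ)), ρ.IsIrreducible ∧ χ = ρ.character}

theorem irrChars_linearIndependent (G : Type*) [Group G] [Finite G] :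
    LinearIndependent ℂ (fun χ : irrChars G => (χ : G → ℂ)) := by
  classical
  have : Fintype G := Fintype.ofFinite G
  have : Invertible (Nat.card G : ℂ) :=
    invertibleOfNonzero (Nat.cast_ne_zero.mpr Nat.card_pos.ne')
  have key : ∀ χ ψ : irrChars G,
      (Nat.card G : ℂ)⁻¹ * ∑ g, χ.1 g * ψ.1 g⁻¹ = if χ = ψ then 1 else 0 := by
    rintro ⟨χ, n, ρ, hρ, rfl⟩ ⟨ψ, m, σ, hσ, rfl⟩
    by_cases h : ρ.character = σ.character
    · simp only [← h, if_true]
      rw [Representation.char_orthonormal ρ ρ,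
        if_pos ⟨Representation.Equiv.refl ρ⟩]
    · have hne : ¬ Nonempty (Representation.Equiv σ ρ) := fun ⟨e⟩ =>
        h (Representation.char_iso e).symm
      rw [Representation.char_orthonormal ρ σ, if_neg hne,
        if_neg (fun e => h (congrArg Subtype.val e))]
  rw [linearIndependent_iff']
  intro s c hc ψ hψ
  have h1 : ∑ χ ∈ s, c χ * ((Nat.card G : ℂ)⁻¹ * ∑ g, χ.1 g * ψ.1 g⁻¹) = 0 := by
    have h2 : ∀ g, ∑ χ ∈ s, c χ * χ.1 g = 0 := fun g => by
      simpa using congrFun hc g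
    calc _ = (Nat.card G : ℂ)⁻¹ * ∑ g, (∑ χ ∈ s, c χ * χ.1 g) * ψ.1 g⁻¹ := by
          simp only [Finset.sum_mul, Finset.mul_sum]
          rw [Finset.sum_comm]
          refine Finset.sum_congr rfl fun _ _ => Finset.sum_congr rfl fun _ _ => ?_
          ring
      _ = 0 := by simp [h2]
  simp only [key] at h1
  simpa [hψ] using h1

instance irrChars_finite (G : Type*) [Group G] [Finite G] : Finite (irrChars G) :=
  (irrChars_linearIndependent G).finite

instance irrCharsFintype (G : Type*) [Group G] [Finite G] : Fintype (irrChars G) :=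
  Fintype.ofFinite _

/-- `P_t = ∑ i, p_i(t) σ_i` for all `t ≥ 0`, with every `σ_i` diagonal in the basis `λ(g)`:
a Kraus-like operator decomposition of `P`. -/
structure IsKrausLikeDecomposition {G ι : Type*} [Group G] [Fintype ι]
    (P : ℝ≥0 → groupAlg G →ₗ[ℂ] groupAlg G)
    (σ : ι → groupAlg G →ₗ[ℂ] groupAlg G) (p : ι → ℝ≥0 → ℂ) : Prop where
  diagonal : ∀ i g, ∃ c : ℂ, σ i (lambdaBasis G g) = c • lambdaBasis G g
  eq_sum : ∀ t, P t = ∑ i, p i t • σ i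

/-- The coefficients `p_χ` form a character-induced Kraus-like decomposition of the semigroup
induced by `l`: `P_t = ∑ χ, p_χ(t) σ_χ`, where `σ_χ λ(g) = χ(g) λ(g)` and `χ` runs over the
irreducible characters. -/
def IsCharacterDecomposition {G : Type*} [Group G] [Finite G] (l : G → ℝ)
    (p : irrChars G → ℝ≥0 → ℂ) : Prop :=
  IsKrausLikeDecomposition (semigroup l) (fun χ : irrChars G => multiplier (χ : G → ℂ)) p

/-- Convexity: the coefficients are nonnegative (as complex numbers: real and `≥ 0`) and
satisfy a sum rule with positive weights that do not depend on `t`. -/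
def IsConvex {ι : Type*} [Fintype ι] (p : ι → ℝ≥0 → ℂ) : Prop :=
  (∀ i t, 0 ≤ p i t) ∧
    ∃ α : ι → ℝ, (∀ i, 0 < α i) ∧ ∀ t, ∑ i, (α i : ℂ) * p i t = 1

/-- Convexity of a character-induced decomposition, with the explicit sum rule
`∑ χ, p_χ(t) χ(e) = 1`. -/
def IsCharacterConvex {G : Type*} [Group G] [Finite G] (p : irrChars G → ℝ≥0 → ℂ) : Prop :=
  (∀ χ t, 0 ≤ p χ t) ∧ ∀ t, ∑ χ : irrChars G, p χ t * (χ : G → ℂ) 1 = 1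

end

end KrausLike

open scoped MonoidAlgebra

/-! ### From operators on the group algebra to functions on the group -/

namespace KrausLike

/-! Comparing coefficients of `λ(g)`, a decomposition is an expansion `e^{-t l} = ∑ p_χ(t) χ` of a
class function in irreducible characters. These form a basis of the class functions, so the `p_χ(t)`
exist and are unique: they are the Fourier coefficients of `e^{-t l}`. Evaluating at `e`, where `l`
vanishes, gives the sum rule for free, with positive weights `χ(e)`; both notions of convexity thus
reduce to nonnegativity of the coefficients.

Nonnegativity of all coefficients means that `e^{-t l}` is positive definite. Characters are
positive definite (`posSemidef_kernelMatrix_irrChar`), hence so are their nonnegative combinations.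
Conversely, a Fourier coefficient pairs two positive-definite functions and is nonnegative by the
Schur product theorem (`sum_mul_inv_nonneg`). Finally, Schoenberg's theorem: `e^{-t l}` is positive
definite for all `t ≥ 0` exactly when `l` is a conditionally negative-definite length. -/

theorem multiplier_injective {G : Type*} [Group G] :
    Function.Injective (multiplier (G := G)) := by
  intro φ ψ h
  funext g
  have h1 := LinearMap.congr_fun h (lambdaBasis G g)
  rw [multiplier_lambda, multiplier_lambda] at h1
  simpa using congrArg (fun x => (lambdaBasis G).repr x g) h1

theorem multiplier_sum_smul {G ι : Type*} [Group G] [Fintype ι] (c : ι → ℂ) (φ : ι → G → ℂ) :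
    multiplier (∑ i, c i • φ i) = ∑ i, c i • multiplier (φ i) := by
  refine (lambdaBasis G).ext fun g => ?_
  simp [multiplier_lambda, Finset.sum_smul, smul_smul]

theorem isCharacterDecomposition_iff {G : Type*} [Group G] [Finite G] (l : G → ℝ)
    (p : irrChars G → ℝ≥0 → ℂ) :
    IsCharacterDecomposition l p ↔ ∀ t : ℝ≥0,
      (fun g => (Real.exp (-(t : ℝ) * l g) : ℂ)) = ∑ χ : irrChars G, p χ t • (χ : G → ℂ) := by
  constructor
  · intro h t
    refine multiplier_injective ?_
    rw [multiplier_sum_smul]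
    exact h.eq_sum t
  · intro h
    refine ⟨fun χ g => ⟨_, multiplier_lambda _ g⟩, fun t => ?_⟩
    rw [← multiplier_sum_smul, ← h t]
    rfl

/-- The matrix `(φ(g⁻¹h))` of a function on `G`. -/
def kernelMatrix {G R : Type*} [Group G] (φ : G → R) : Matrix G G R :=
  Matrix.of fun g h => φ (g⁻¹ * h)

@[simp]
theorem kernelMatrix_apply {G R : Type*} [Group G] (φ : G → R) (g h : G) :
    kernelMatrix φ g h = φ (g⁻¹ * h) := rfl

/-! ### Positive definiteness of characters -/

section

variable {G : Type*} [Group G] [Fintype G]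
open Matrix

/-- Weyl's averaging trick: `∑ (R h)ᴴ R h` is an invariant form, positive definite because the term
`h = 1` is the identity. Conjugating by a factor `C` of it makes `R` unitary. -/
theorem exists_isUnit_unitarizing {n : Type*} [Fintype n] [DecidableEq n]
    (R : G →* Matrix n n ℂ) :
    ∃ C : Matrix n n ℂ, IsUnit C ∧ ∀ g, (R g)ᴴ * (Cᴴ * C) * R g = Cᴴ * C := by
  classical
  have hM : (∑ h : G, (R h)ᴴ * R h).PosDef := by
    rw [← Finset.add_sum_erase _ _ (Finset.mem_univ (1 : G))]
    refine Matrix.PosDef.add_posSemidef (by simpa using Matrix.PosDef.one) ?_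
    exact Matrix.posSemidef_sum _ fun i _ => Matrix.posSemidef_conjTranspose_mul_self _
  obtain ⟨C, hC⟩ : ∃ C : Matrix n n ℂ, (∑ h : G, (R h)ᴴ * R h) = Cᴴ * C := by
    open scoped MatrixOrder Matrix.Norms.L2Operator in
    exact CStarAlgebra.nonneg_iff_eq_star_mul_self.mp hM.posSemidef.nonneg
  refine ⟨C, ?_, fun g => ?_⟩
  · have := hM.isUnit
    rw [hC] at this
    exact isUnit_of_mul_isUnit_right this
  · rw [← hC, Finset.mul_sum, Finset.sum_mul, ← Equiv.sum_comp (Equiv.mulRight g) fun h => (R h)ᴴ * R h]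
    refine Finset.sum_congr rfl fun h _ => ?_
    simp [Matrix.mul_assoc]

/-- For the unitary conjugate `U` of `R`, `tr R(g⁻¹h) = tr (U(g)ᴴ U(h))`, so the kernel is the Gram
matrix of the `U(g)` in the Hilbert–Schmidt inner product. -/
theorem posSemidef_kernelMatrix_trace {n : Type*} [Fintype n] [DecidableEq n]
    (R : G →* Matrix n n ℂ) : (kernelMatrix fun g => (R g).trace).PosSemidef := by
  obtain ⟨C, hC, hR⟩ := exists_isUnit_unitarizing R
  have hC' : IsUnit C.det := (Matrix.isUnit_iff_isUnit_det C).1 hC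
  let U : G → Matrix n n ℂ := fun g => C * R g * C⁻¹
  have hU : ∀ g, (U g)ᴴ = C * R g⁻¹ * C⁻¹ := by
    intro g
    have h1 : (R g)ᴴ * Cᴴ = Cᴴ * C * R g⁻¹ * C⁻¹ := by
      have : R g * R g⁻¹ = 1 := by rw [← map_mul, mul_inv_cancel, map_one]
      rw [← hR g, Matrix.mul_assoc _ (R g), this, Matrix.mul_one, Matrix.mul_assoc,
        Matrix.mul_assoc Cᴴ, Matrix.mul_nonsing_inv _ hC', Matrix.mul_one]
    have hCH : IsUnit Cᴴ.det := by simpa [Matrix.det_conjTranspose] using hC'.star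
    simp only [U, Matrix.conjTranspose_mul]
    rw [h1, Matrix.conjTranspose_nonsing_inv]
    simp only [Matrix.mul_assoc]
    rw [Matrix.nonsing_inv_mul_cancel_left _ _ hCH]
  let W : Matrix (n × n) G ℂ := Matrix.of fun k g => U g k.1 k.2
  have hW : (kernelMatrix fun g => (R g).trace) = Wᴴ * W := by
    ext g h
    have h1 : (R (g⁻¹ * h)).trace = ((U g)ᴴ * U h).trace := by
      rw [hU]
      have : C * R g⁻¹ * C⁻¹ * (C * R h * C⁻¹) = C * R (g⁻¹ * h) * C⁻¹ := by
        simp only [Matrix.mul_assoc, map_mul]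
        rw [Matrix.nonsing_inv_mul_cancel_left _ _ hC']
      simp only [U]
      rw [this, Matrix.trace_mul_cycle, Matrix.nonsing_inv_mul _ hC', Matrix.one_mul]
    rw [kernelMatrix_apply, h1]
    simp only [Matrix.trace, Matrix.diag, Matrix.mul_apply, Matrix.conjTranspose_apply, W,
      Matrix.of_apply, Fintype.sum_prod_type]
    rw [Finset.sum_comm]
  rw [hW]
  exact Matrix.posSemidef_conjTranspose_mul_self W

theorem posSemidef_kernelMatrix_irrChar (χ : irrChars G) :
    (kernelMatrix (χ : G → ℂ)).PosSemidef := by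
  obtain ⟨χ, n, ρ, hρ, rfl⟩ := χ
  have := posSemidef_kernelMatrix_trace
    ((LinearMap.toMatrixAlgEquiv' (R := ℂ) (n := Fin n)).toMonoidHom.comp ρ)
  convert this using 2
  funext g
  simp [Representation.character, LinearMap.trace_eq_matrix_trace ℂ (Pi.basisFun ℂ (Fin n))]
  rfl

/-- The Fourier coefficient of a positive-definite function at a positive-definite character. -/
theorem sum_mul_inv_nonneg {φ ψ : G → ℂ} (hφ : (kernelMatrix φ).PosSemidef)
    (hψ : (kernelMatrix ψ).PosSemidef) : 0 ≤ ∑ g, φ g * ψ g⁻¹ := by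
  -- The Hadamard product has entries `φ(g⁻¹h) ψ((g⁻¹h)⁻¹)`; its quadratic form at the all-ones
  -- vector is `|G|` times the sum sought.
  have h := (hφ.hadamard hψ.transpose).dotProduct_mulVec_nonneg (fun _ => 1)
  have h2 : (0 : ℂ) ≤ ∑ g : G, ∑ h : G, φ (g⁻¹ * h) * ψ (g⁻¹ * h)⁻¹ := by
    simpa [dotProduct, Matrix.mulVec, Finset.mul_sum, Pi.star_def] using h
  have h3 : ∀ g : G, ∑ h : G, φ (g⁻¹ * h) * ψ (g⁻¹ * h)⁻¹ = ∑ g, φ g * ψ g⁻¹ := fun g =>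
    Equiv.sum_comp (Equiv.mulLeft g⁻¹) fun g => φ g * ψ g⁻¹
  simp only [h3, Finset.sum_const, nsmul_eq_mul] at h2
  have hcard : (0 : ℂ) < (Finset.univ : Finset G).card := by
    exact_mod_cast Fintype.card_pos (α := G)
  exact le_of_mul_le_mul_of_pos_left (by simpa using h2) hcard

end

/-! ### Completeness of the irreducible characters -/

section

variable {G : Type*} [Group G] [Fintype G]

/-- A choice of basis carries a simple left ideal to some `ℂⁿ`, the only spaces admitted in
`irrChars`. -/
theorem exists_irrChar_eq_trace (S : Submodule ℂ[G] ℂ[G]) [IsSimpleModule ℂ[G] S] :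
    ∃ χ : irrChars G, ∀ g,
      χ.1 g = LinearMap.trace ℂ S (Algebra.lsmul ℂ ℂ S (MonoidAlgebra.of ℂ G g)) := by
  let e : S ≃ₗ[ℂ] (Fin (Module.finrank ℂ S) → ℂ) := (Module.finBasis ℂ S).equivFun
  let A : ℂ[G] →ₐ[ℂ] Module.End ℂ (Fin (Module.finrank ℂ S) → ℂ) :=
    (e.conjAlgEquiv ℂ).toAlgHom.comp (Algebra.lsmul ℂ ℂ S)
  let σ : Representation ℂ G (Fin (Module.finrank ℂ S) → ℂ) := (MonoidAlgebra.lift ℂ _ G).symm A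
  have hσ : σ.asAlgebraHom = A := (MonoidAlgebra.lift ℂ _ G).apply_symm_apply A
  let f : S ≃ₗ[ℂ[G]] σ.asModule :=
    { (e.trans σ.asModuleEquiv.symm).toAddEquiv with
      map_smul' := fun r x => by
        apply σ.asModuleEquiv.injective
        rw [RingHom.id_apply, Representation.asModuleEquiv_map_smul, hσ]
        simp [A, LinearEquiv.conjAlgEquiv_apply] }
  have hirr : σ.IsIrreducible := by
    rw [Representation.irreducible_iff_isSimpleModule_asModule]
    exact IsSimpleModule.congr f.symm
  refine ⟨⟨σ.character, _, σ, hirr, rfl⟩, fun g => ?_⟩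
  have : σ g = e.conj (Algebra.lsmul ℂ ℂ S (MonoidAlgebra.of ℂ G g)) := by
    rfl
  show LinearMap.trace ℂ _ (σ g) = _
  rw [this, LinearMap.trace_conj']

/-- By Schur's lemma the central element acts on `S` as a scalar `c`, so its trace is `c · dim S`
with `dim S ≠ 0`. -/
theorem smul_eq_zero_of_isSimpleModule {z : ℂ[G]} (hz : ∀ x, Commute z x)
    (S : Submodule ℂ[G] ℂ[G]) [IsSimpleModule ℂ[G] S]
    (htr : LinearMap.trace ℂ S (Algebra.lsmul ℂ ℂ S z) = 0) (s : S) : z • s = 0 := by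
  let T : Module.End ℂ[G] S :=
    { toFun := fun s => z • s
      map_add' := smul_add z
      map_smul' := fun r s => by simp only [smul_smul, (hz r).eq, RingHom.id_apply] }
  obtain ⟨c, hc⟩ := (IsSimpleModule.algebraMap_end_bijective_of_isAlgClosed
    (A := ℂ[G]) (V := S) ℂ).2 T
  have hT : ∀ s : S, z • s = c • s := fun s => (LinearMap.congr_fun hc s).symm
  have hT' : Algebra.lsmul ℂ ℂ S z = c • LinearMap.id := LinearMap.ext fun s => hT s
  rw [hT', map_smul, LinearMap.trace_id, smul_eq_mul, mul_eq_zero] at htr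
  have : Nontrivial S := IsSimpleModule.nontrivial ℂ[G] S
  have hd : (Module.finrank ℂ S : ℂ) ≠ 0 := by
    exact_mod_cast (Module.finrank_pos (R := ℂ) (M := S)).ne'
  rw [hT, htr.resolve_right hd, zero_smul]

/-- The irreducible characters separate class functions. -/
theorem eq_zero_of_forall_irrChar {f : G → ℂ} (hf : ∀ g h, f g = f (h⁻¹ * g * h))
    (h : ∀ χ : irrChars G, ∑ g, f g * χ.1 g⁻¹ = 0) : f = 0 := by
  classical
  -- The inverse in `∑ f(g) g⁻¹` makes the trace of `z` on a simple ideal with character `χ` equal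
  -- to the pairing in `h`.
  let z : ℂ[G] := ∑ g, MonoidAlgebra.single g⁻¹ (f g)
  have hz : ∀ x, Commute z x := by
    intro x
    induction x using MonoidAlgebra.induction_on with
    | of k =>
      show z * MonoidAlgebra.of ℂ G k = MonoidAlgebra.of ℂ G k * z
      simp only [z, Finset.sum_mul, Finset.mul_sum, MonoidAlgebra.of_apply,
        MonoidAlgebra.single_mul_single, mul_one, one_mul]
      rw [← Equiv.sum_comp (MulAut.conj k).toEquiv]
      refine Finset.sum_congr rfl fun g _ => ?_
      rw [hf _ k]
      simp [mul_assoc]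
    | add x y hx hy => exact hx.add_right hy
    | smul c x hx => exact hx.smul_right c
  have hS : ∀ S : Submodule ℂ[G] ℂ[G], IsSimpleModule ℂ[G] S → ∀ s ∈ S, z * s = 0 := by
    intro S _ s hs
    obtain ⟨χ, hχ⟩ := exists_irrChar_eq_trace S
    have : LinearMap.trace ℂ S (Algebra.lsmul ℂ ℂ S z) = 0 := by
      rw [← h χ]
      simp only [z, map_sum, hχ]
      refine Finset.sum_congr rfl fun g _ => ?_
      have : MonoidAlgebra.single g⁻¹ (f g) = f g • MonoidAlgebra.of ℂ G g⁻¹ := by simp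
      rw [this, map_smul, map_smul, smul_eq_mul]
    exact congrArg Subtype.val (smul_eq_zero_of_isSimpleModule hz S this ⟨s, hs⟩)
  -- By semisimplicity the simple left ideals span `ℂ[G]`. The kernel of `x ↦ x z` is a left ideal
  -- containing each of them, so `z = 1 · z = 0`.
  have hker : (⊤ : Submodule ℂ[G] ℂ[G]) ≤
      LinearMap.ker (LinearMap.toSpanSingleton ℂ[G] ℂ[G] z) := by
    rw [← IsSemisimpleModule.sSup_simples_eq_top ℂ[G] ℂ[G]]
    refine sSup_le fun S hSs s hs => ?_
    simpa [← (hz s).eq] using hS S hSs s hs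
  have hz0 : z = 0 := by simpa using hker (Submodule.mem_top (x := (1 : ℂ[G])))
  funext g
  have := congrArg (fun x : ℂ[G] => x.coeff g⁻¹) hz0
  simpa [z, MonoidAlgebra.coeff_sum, Finsupp.single_apply] using this

end

/-! ### Schoenberg's theorem -/

section

variable {G : Type*} [Group G] [Fintype G]
open Matrix Filter Topology

/-- Entrywise powers are positive semidefinite by the Schur product theorem, and the exponential
series combines them with nonnegative coefficients. -/
theorem posSemidef_map_exp {n : Type*} [Fintype n] {A : Matrix n n ℂ} (hA : A.PosSemidef) :
    (A.map Complex.exp).PosSemidef := by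
  have hpow : ∀ k : ℕ, (A.map (· ^ k)).PosSemidef := by
    intro k
    induction k with
    | zero =>
      convert Matrix.posSemidef_vecMulVec_self_star (fun _ : n => (1 : ℂ)) using 1
      ext i j
      simp [Matrix.vecMulVec_apply]
    | succ k ih =>
      have : A.map (· ^ (k + 1)) = (A.map (· ^ k)).hadamard A := by
        ext i j
        simp [pow_succ]
      rw [this]
      exact ih.hadamard hA
  refine Matrix.PosSemidef.of_dotProduct_mulVec_nonneg ?_ fun x => ?_
  · ext i j
    simp [← Complex.exp_conj, ← hA.isHermitian.apply i j]
  · have hs : HasSum (fun k : ℕ => ((k.factorial : ℝ) : ℂ)⁻¹ * (star x ⬝ᵥ A.map (· ^ k) *ᵥ x))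
        (star x ⬝ᵥ A.map Complex.exp *ᵥ x) := by
      simp only [dotProduct, mulVec, Finset.mul_sum, Matrix.map_apply]
      refine hasSum_sum fun i _ => hasSum_sum fun j _ => ?_
      have h := NormedSpace.expSeries_div_hasSum_exp (A i j)
      rw [← Complex.exp_eq_exp_ℂ] at h
      have h' := (h.mul_left (star x i)).mul_right (x j)
      rw [mul_assoc] at h'
      refine h'.congr_fun fun k => ?_
      push_cast
      ring
    refine hs.nonneg fun k => mul_nonneg ?_ ((hpow k).dotProduct_mulVec_nonneg x)
    rw [← Complex.ofReal_inv]
    exact_mod_cast inv_nonneg.2 (Nat.cast_nonneg _)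

theorem IsCondNegDefLength.sum_nonpos_fintype {G ι : Type*} [Group G] [Fintype ι] {l : G → ℝ}
    (hl : IsCondNegDefLength l) (α : ι → ℂ) (g : ι → G) (hα : ∑ i, α i = 0) :
    ∑ i, ∑ j, α i * starRingEnd ℂ (α j) * (l ((g i)⁻¹ * g j) : ℂ) ≤ 0 := by
  let e := (Fintype.equivFin ι).symm
  have := hl.sum_nonpos _ (α ∘ e) (g ∘ e) (by rw [← hα]; exact Equiv.sum_comp e α)
  rw [← Equiv.sum_comp e]
  simp_rw [← Equiv.sum_comp e]
  exact this

/-- Arbitrary weights on `G` become weights of sum zero once an extra point at the identity carries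
minus their total; since `l 1 = 0`, the terms involving that point produce `l g + l h`. -/
theorem IsCondNegDefLength.posSemidef {l : G → ℝ} (hl : IsCondNegDefLength l) :
    (Matrix.of fun g h : G => ((l g + l h - l (g⁻¹ * h) : ℝ) : ℂ)).PosSemidef := by
  refine Matrix.PosSemidef.of_dotProduct_mulVec_nonneg ?_ fun x => ?_
  · ext g h
    have : l (h⁻¹ * g) = l (g⁻¹ * h) := by rw [hl.map_inv]; simp
    simp [this, add_comm]
  · have h := hl.sum_nonpos_fintype
      (fun o : Option G => o.elim (-∑ g, starRingEnd ℂ (x g)) fun g => starRingEnd ℂ (x g))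
      (fun o => o.elim 1 id) (by simp [Fintype.sum_option])
    rw [← neg_nonneg] at h
    convert h using 1
    have hinv : ∀ g, l g⁻¹ = l g := fun g => (hl.map_inv g).symm
    simp only [dotProduct, mulVec, Fintype.sum_option, Option.elim, id, hl.map_one, hinv,
      inv_one, one_mul, mul_one, Matrix.of_apply, Pi.star_apply, map_neg, map_sum,
      Complex.conj_conj, Complex.ofReal_zero, mul_zero, zero_add, Finset.sum_add_distrib]
    simp only [Finset.mul_sum, Finset.sum_mul, neg_mul, mul_neg, Finset.sum_neg_distrib,
      Complex.ofReal_sub, Complex.ofReal_add, sub_mul, add_mul, mul_sub, mul_add,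
      Finset.sum_add_distrib, Finset.sum_sub_distrib]
    have e1 : ∑ i, ∑ j, starRingEnd ℂ (x j) * x i * (l i : ℂ) =
        ∑ i, ∑ j, star (x i) * ((l j : ℂ) * x j) := by
      rw [Finset.sum_comm]
      refine Finset.sum_congr rfl fun i _ => Finset.sum_congr rfl fun j _ => ?_
      simp only [starRingEnd_apply]; ring
    have e2 : ∑ i, ∑ j, starRingEnd ℂ (x i) * x j * (l i : ℂ) =
        ∑ i, ∑ j, star (x i) * ((l i : ℂ) * x j) := by
      refine Finset.sum_congr rfl fun i _ => Finset.sum_congr rfl fun j _ => ?_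
      simp only [starRingEnd_apply]; ring
    have e3 : ∑ i, ∑ j, starRingEnd ℂ (x i) * x j * (l (i⁻¹ * j) : ℂ) =
        ∑ i, ∑ j, star (x i) * ((l (i⁻¹ * j) : ℂ) * x j) := by
      refine Finset.sum_congr rfl fun i _ => Finset.sum_congr rfl fun j _ => ?_
      simp only [starRingEnd_apply]; ring
    rw [e1, e2, e3]
    ring

/-- Schoenberg's theorem, exponential direction. -/
theorem IsCondNegDefLength.posSemidef_exp {l : G → ℝ} (hl : IsCondNegDefLength l) {t : ℝ}
    (ht : 0 ≤ t) : (kernelMatrix fun g : G => (Real.exp (-t * l g) : ℂ)).PosSemidef := by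
  have h1 := posSemidef_map_exp (hl.posSemidef.smul ht)
  have h2 := Matrix.posSemidef_vecMulVec_self_star fun g : G => (Real.exp (-t * l g) : ℂ)
  -- `e^{-t l(g⁻¹h)} = e^{-t l(g)} e^{-t l(h)} · e^{t (l(g) + l(h) - l(g⁻¹h))}`: a rank-one matrix
  -- times an entrywise exponential.
  have h3 : (kernelMatrix fun g : G => (Real.exp (-t * l g) : ℂ)) =
      (Matrix.vecMulVec (fun g : G => (Real.exp (-t * l g) : ℂ))
        (star fun g : G => (Real.exp (-t * l g) : ℂ))).hadamard
        ((t • Matrix.of fun g h : G => ((l g + l h - l (g⁻¹ * h) : ℝ) : ℂ)).map Complex.exp) := by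
    ext g h
    simp only [kernelMatrix_apply, Matrix.hadamard_apply, Matrix.vecMulVec_apply,
      Matrix.map_apply, Matrix.smul_apply, Matrix.of_apply, Pi.star_apply, Complex.real_smul,
      ← Complex.ofReal_mul, ← Complex.ofReal_exp, RCLike.star_def, Complex.conj_ofReal,
      ← Real.exp_add]
    congr 2
    ring
  rw [h3]
  exact h2.hadamard h1

omit [Fintype G] in
theorem sum_mul_conj_nonneg_of_posSemidef {φ : G → ℂ} (h : (kernelMatrix φ).PosSemidef)
    {ι : Type*} [Fintype ι] (α : ι → ℂ) (g : ι → G) :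
    0 ≤ ∑ i, ∑ j, α i * starRingEnd ℂ (α j) * φ ((g i)⁻¹ * g j) := by
  convert (h.submatrix g).dotProduct_mulVec_nonneg (star α) using 1
  simp only [dotProduct, mulVec, Finset.mul_sum, Matrix.submatrix_apply, kernelMatrix_apply,
    star_star, Pi.star_apply, starRingEnd_apply]
  refine Finset.sum_congr rfl fun i _ => Finset.sum_congr rfl fun j _ => ?_
  ring

omit [Fintype G] in
/-- Schoenberg's theorem, infinitesimal direction. -/
theorem isCondNegDefLength_of_posSemidef_exp {l : G → ℝ} (hone : l 1 = 0)
    (h : ∀ t : ℝ, 0 ≤ t → (kernelMatrix fun g : G => (Real.exp (-t * l g) : ℂ)).PosSemidef) :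
    IsCondNegDefLength l where
  map_one := hone
  map_inv g := by
    have := (h 1 zero_le_one).isHermitian.apply 1 g
    simp only [kernelMatrix_apply, RCLike.star_def, Complex.conj_ofReal, Complex.ofReal_inj,
      mul_one, inv_one, one_mul, Real.exp_eq_exp] at this
    linarith
  nonneg g := by
    -- Weights `1, -1` at the points `1, g` give `2 - e^{-l(g)} - e^{-l(g⁻¹)} ≥ 0`; with the
    -- Hermitian symmetry this says `e^{-l(g)} ≤ 1`.
    have h1 := sum_mul_conj_nonneg_of_posSemidef (h 1 zero_le_one) ![1, -1] ![1, g]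
    have h2 := sum_mul_conj_nonneg_of_posSemidef (h 1 zero_le_one) ![1, -1] ![1, g⁻¹]
    have h3 := add_nonneg h1 h2
    simp only [Fin.sum_univ_two, Matrix.cons_val_zero, Matrix.cons_val_one] at h3
    have h4 : 0 ≤ 4 - 2 * Real.exp (-l g) - 2 * Real.exp (-l g⁻¹) := by
      rw [← Complex.zero_le_real]
      convert h3 using 1
      simp [hone]
      ring
    have := (h 1 zero_le_one).isHermitian.apply 1 g
    simp only [kernelMatrix_apply, RCLike.star_def, Complex.conj_ofReal, Complex.ofReal_inj,
      mul_one, inv_one, one_mul, neg_mul] at this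
    rw [this] at h4
    have : Real.exp (-l g) ≤ 1 := by linarith
    simpa using this
  sum_nonpos n α g hα := by
    -- `F ≥ 0` on `t ≥ 0` and `F 0 = |∑ α i|² = 0`, so the derivative at `0`, which is minus the sum
    -- to be bounded, is nonnegative as a limit of slopes from the right.
    let F : ℝ → ℂ := fun t =>
      ∑ i, ∑ j, α i * starRingEnd ℂ (α j) * (Real.exp (-t * l ((g i)⁻¹ * g j)) : ℂ)
    have hF0 : F 0 = 0 := by
      simp [F, ← Finset.mul_sum, ← Finset.sum_mul, hα]
    have hF : HasDerivAt F
        (∑ i, ∑ j, α i * starRingEnd ℂ (α j) * ((-l ((g i)⁻¹ * g j) : ℝ) : ℂ)) 0 := by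
      refine HasDerivAt.fun_sum fun i _ => HasDerivAt.fun_sum fun j _ => ?_
      refine HasDerivAt.const_mul _ (HasDerivAt.ofReal_comp ?_)
      have := (((hasDerivAt_id (0 : ℝ)).neg).mul_const (l ((g i)⁻¹ * g j))).exp
      simpa using this
    have hlim := (hF.tendsto_slope).mono_left (nhdsGT_le_nhdsNE (0 : ℝ))
    have hnn := ge_of_tendsto (b := (0 : ℂ)) hlim <| by
      filter_upwards [self_mem_nhdsWithin] with t ht
      have ht : 0 < t := ht
      rw [slope_def_module, hF0, sub_zero, sub_zero]
      exact smul_nonneg (inv_nonneg.2 ht.le)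
        (sum_mul_conj_nonneg_of_posSemidef (h t ht.le) α g)
    rw [← neg_nonneg]
    convert hnn using 1
    simp

end

/-! ### Fourier coefficients and the equivalence -/

section

variable {G : Type*} [Group G] [Fintype G]
open Classical in
theorem irrChars_orthonormal (χ ψ : irrChars G) :
    (Nat.card G : ℂ)⁻¹ * ∑ g, χ.1 g * ψ.1 g⁻¹ = if χ = ψ then 1 else 0 := by
  have : Invertible (Nat.card G : ℂ) :=
    invertibleOfNonzero (Nat.cast_ne_zero.mpr Nat.card_pos.ne')
  obtain ⟨χ, n, ρ, hρ, rfl⟩ := χ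
  obtain ⟨ψ, m, σ, hσ, rfl⟩ := ψ
  by_cases h : ρ.character = σ.character
  · simp only [← h, if_true]
    rw [Representation.char_orthonormal ρ ρ, if_pos ⟨Representation.Equiv.refl ρ⟩]
  · rw [Representation.char_orthonormal ρ σ,
      if_neg fun ⟨e⟩ => h (Representation.char_iso e).symm,
      if_neg fun e => h (congrArg Subtype.val e)]

omit [Fintype G] in
theorem irrChar_conj (χ : irrChars G) (g h : G) : χ.1 g = χ.1 (h⁻¹ * g * h) := by
  obtain ⟨χ, n, ρ, hρ, rfl⟩ := χ
  simpa using (Representation.char_conj ρ g h⁻¹).symm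

/-- The Fourier coefficient of `f` at the character `χ`. -/
noncomputable def charCoeff (f : G → ℂ) (χ : irrChars G) : ℂ :=
  (Nat.card G : ℂ)⁻¹ * ∑ g, f g * χ.1 g⁻¹

theorem charCoeff_sum_smul (c : irrChars G → ℂ) (ψ : irrChars G) :
    charCoeff (∑ χ, c χ • (χ : G → ℂ)) ψ = c ψ := by
  classical
  have h : charCoeff (∑ χ, c χ • (χ : G → ℂ)) ψ =
      ∑ χ, c χ * ((Nat.card G : ℂ)⁻¹ * ∑ g, χ.1 g * ψ.1 g⁻¹) := by
    simp only [charCoeff, Finset.sum_apply, Pi.smul_apply, smul_eq_mul, Finset.sum_mul,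
      Finset.mul_sum]
    rw [Finset.sum_comm]
    refine Finset.sum_congr rfl fun _ _ => Finset.sum_congr rfl fun _ _ => ?_
    ring
  simp only [h, irrChars_orthonormal]
  simp

/-- The expansion of a class function in irreducible characters. -/
theorem eq_sum_charCoeff_smul {f : G → ℂ} (hf : ∀ g h, f g = f (h⁻¹ * g * h)) :
    f = ∑ χ, charCoeff f χ • (χ : G → ℂ) := by
  -- The difference of `f` and its expansion is a class function orthogonal to every irreducible
  -- character.
  rw [← sub_eq_zero]
  refine eq_zero_of_forall_irrChar (fun g h => ?_) fun ψ => ?_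
  · simp only [Pi.sub_apply, Finset.sum_apply, Pi.smul_apply, ← hf g h, ← irrChar_conj _ g h]
  · have h := charCoeff_sum_smul (charCoeff f) ψ
    have hc : (Nat.card G : ℂ)⁻¹ ≠ 0 := inv_ne_zero (Nat.cast_ne_zero.2 Nat.card_pos.ne')
    simp only [charCoeff] at h
    have h' := mul_left_cancel₀ hc h
    simp only [Pi.sub_apply, sub_mul, Finset.sum_sub_distrib]
    rw [sub_eq_zero]
    exact h'.symm

theorem charCoeff_nonneg {f : G → ℂ} (hf : (kernelMatrix f).PosSemidef) (χ : irrChars G) :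
    0 ≤ charCoeff f χ :=
  mul_nonneg (by rw [← Complex.ofReal_natCast, ← Complex.ofReal_inv]; exact_mod_cast by positivity)
    (sum_mul_inv_nonneg hf (posSemidef_kernelMatrix_irrChar χ))

theorem posSemidef_kernelMatrix_sum_smul {c : irrChars G → ℂ} (hc : ∀ χ, 0 ≤ c χ) :
    (kernelMatrix (∑ χ, c χ • (χ : G → ℂ))).PosSemidef := by
  have : kernelMatrix (∑ χ, c χ • (χ : G → ℂ)) = ∑ χ, c χ • kernelMatrix (χ : G → ℂ) := by
    ext g h
    simp [Matrix.sum_apply]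
  rw [this]
  exact Matrix.posSemidef_sum _ fun χ _ => (posSemidef_kernelMatrix_irrChar χ).smul (hc χ)

omit [Fintype G] in
-- The value at the identity is the dimension, nonzero since a simple module is nontrivial. These
-- numbers serve as weights in the general sum rule.
theorem irrChar_one_pos (χ : irrChars G) : ∃ d : ℝ, 0 < d ∧ χ.1 1 = d := by
  obtain ⟨χ, n, ρ, hρ, rfl⟩ := χ
  refine ⟨n, ?_, by simp⟩
  have : Nontrivial (Fin n → ℂ) :=
    have := (Representation.irreducible_iff_isSimpleModule_asModule ρ).1 hρ
    IsSimpleModule.nontrivial (MonoidAlgebra ℂ G) ρ.asModule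
  rcases Nat.eq_zero_or_pos n with rfl | h
  · exact absurd this (not_nontrivial _)
  · exact_mod_cast h

/-- For a character-induced decomposition, nonnegativity of the coefficients is equivalent to
conditional negative definiteness. -/
theorem IsCharacterDecomposition.nonneg_iff {l : G → ℝ} (hone : l 1 = 0)
    {p : irrChars G → ℝ≥0 → ℂ} (hp : IsCharacterDecomposition l p) :
    (∀ χ t, 0 ≤ p χ t) ↔ IsCondNegDefLength l := by
  rw [isCharacterDecomposition_iff] at hp
  constructor
  · intro h
    refine isCondNegDefLength_of_posSemidef_exp hone fun t ht => ?_
    refine (congrArg (fun f => (kernelMatrix f).PosSemidef) (hp ⟨t, ht⟩)).mpr ?_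
    exact posSemidef_kernelMatrix_sum_smul fun χ => h χ ⟨t, ht⟩
  · intro hl χ t
    rw [← charCoeff_sum_smul (fun χ => p χ t) χ, ← hp t]
    exact charCoeff_nonneg (hl.posSemidef_exp t.2) χ

/-- The sum rule holds automatically. -/
theorem IsCharacterDecomposition.sum_mul_one {l : G → ℝ} (hone : l 1 = 0)
    {p : irrChars G → ℝ≥0 → ℂ} (hp : IsCharacterDecomposition l p) (t : ℝ≥0) :
    ∑ χ : irrChars G, p χ t * (χ : G → ℂ) 1 = 1 := by
  have := congrFun ((isCharacterDecomposition_iff l p).1 hp t) 1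
  simpa [hone] using this.symm

theorem existsUnique_isCharacterDecomposition {l : G → ℝ} (hl : IsClassFunction l) :
    ∃! p : irrChars G → ℝ≥0 → ℂ, IsCharacterDecomposition l p := by
  refine ⟨fun χ t => charCoeff (fun g => (Real.exp (-(t : ℝ) * l g) : ℂ)) χ, ?_, fun p hp => ?_⟩
  · refine (isCharacterDecomposition_iff l _).2 fun t => eq_sum_charCoeff_smul fun g h => ?_
    rw [← hl g h]
  · funext χ t
    rw [(isCharacterDecomposition_iff l p).1 hp t, charCoeff_sum_smul fun χ => p χ t]

end
end KrausLike

theorem mainTheorem3 {G : Type*} [Group G] [Finite G] (l : G → ℝ)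
    (hclass : KrausLike.IsClassFunction l) (hone : l 1 = 0) :
    (∃! p : KrausLike.irrChars G → NNReal → ℂ, KrausLike.IsCharacterDecomposition l p) ∧
    ∀ p : KrausLike.irrChars G → NNReal → ℂ, KrausLike.IsCharacterDecomposition l p →
      ((KrausLike.IsCharacterConvex p ↔ KrausLike.IsCondNegDefLength l) ∧
        (KrausLike.IsConvex p ↔ KrausLike.IsCondNegDefLength l)) := by
  have : Fintype G := Fintype.ofFinite G
  refine ⟨KrausLike.existsUnique_isCharacterDecomposition hclass, fun p hp => ⟨?_, ?_⟩⟩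
  · rw [← hp.nonneg_iff hone]
    exact ⟨And.left, fun h => ⟨h, hp.sum_mul_one hone⟩⟩
  · rw [← hp.nonneg_iff hone]
    choose d hd hχ using KrausLike.irrChar_one_pos (G := G)
    refine ⟨And.left, fun h => ⟨h, d, hd, fun t => ?_⟩⟩
    rw [← hp.sum_mul_one hone t]
    exact Finset.sum_congr rfl fun χ _ => by rw [hχ, mul_comm]
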